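/- Let $H$ be a closed, densely defined linear operator on a complex Banach space $\mathcal B$ with spectrum $\sigma(H)\subseteq\mathbb R$, and suppose that for some $\alpha\ge 0$ and some constant $c$ $$\|(z-H)^{-1}\|\le c\,|\operatorname{Im} z|^{-1}\left(\frac{\langle z\rangle}{|\operatorname{Im} z|}\right)^{\alpha}\qquad\text{for all } z\in\mathbb C\setminus\mathbb R,\qquad \langle z\rangle:=(1+|z|^2)^{1/2}.$$ Let $\mathcal A=\bigcup_{\beta<0}S^\beta$, where $S^\beta$ is the set of smooth functions $f:\mathbb R\to\mathbb C$ such that for every $m\ge 0$ there is $c_m>0$ with $|f^{(m)}(x)|\le c_m\langle x\rangle^{\beta-m}$ for all $x\in\mathbb R$. For $f\in\mathcal A$ define $$f(H):=-\frac1\pi\iint_{\mathbb C}\frac{\partial\tilde f}{\partial\bar z}\,(z-H)^{-1}\,dx\,dy,\qquad \tilde f(x,y):=\Big(\sum_{r=0}^{n}f^{(r)}(x)\frac{(iy)^r}{r!}\Big)\tau(x,y),\qquad \frac{\partial}{\partial\bar z}:=\frac12\Big(\frac{\partial}{\partial x}+i\frac{\partial}{\partial y}\Big),$$ where $z=x+iy$,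 $n>\alpha$ is any integer, and $\tau:\mathbb R^2\to\mathbb R$ is any smooth function with $\tau(x,y)=1$ for $|y|\le\langle x\rangle$, $\tau(x,y)=0$ for $|y|\ge 2\langle x\rangle$, and $|\partial_x\tau(x,y)|+|\partial_y\tau(x,y)|\le C\langle x\rangle^{-1}$ for all $x,y$ and some constant $C$. Then, for every $f\in\mathcal A$ and every such choice of $n$ and $\tau$, the integral defining $f(H)$ converges absolutely in operator norm, and $$\overline{f(\sigma(H))}\subseteq\sigma(f(H)).$$ -/

import Mathlib

open MeasureTheory
open scoped ContDiff

noncomputable section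

namespace HelfferSjostrand

/-! ### Resolvents and spectra of unbounded operators -/

section Operators

variable {B : Type*} [NormedAddCommGroup B] [NormedSpace ℂ B]

/-- The bounded operator `R` is a two-sided inverse of `z - H : Dom(H) → B`. -/
def IsResolventAt (H : B →ₗ.[ℂ] B) (z : ℂ) (R : B →L[ℂ] B) : Prop :=
  (∀ y : B, ∃ x : H.domain, (x : B) = R y ∧ z • (x : B) - H x = y) ∧
    ∀ x : H.domain, R (z • (x : B) - H x) = x

/-- The resolvent set: those `z` for which `z - H` is a bijection of `Dom(H)` onto `B` with
bounded inverse. -/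
def opResolventSet (H : B →ₗ.[ℂ] B) : Set ℂ := {z | ∃ R : B →L[ℂ] B, IsResolventAt H z R}

/-- The spectrum `σ(H)` of a partially defined operator. -/
def opSpectrum (H : B →ₗ.[ℂ] B) : Set ℂ := (opResolventSet H)ᶜ

open Classical in
/-- The resolvent operator `(z - H)⁻¹` for `z` in the resolvent set (and `0` elsewhere). -/
def opResolvent (H : B →ₗ.[ℂ] B) (z : ℂ) : B →L[ℂ] B :=
  if h : ∃ R : B →L[ℂ] B, IsResolventAt H z R then h.choose else 0

theorem IsResolventAt.unique {H : B →ₗ.[ℂ] B} {z : ℂ} {R S : B →L[ℂ] B}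
    (hR : IsResolventAt H z R) (hS : IsResolventAt H z S) : R = S := by
  ext y
  obtain ⟨x, hx, hy⟩ := hR.1 y
  have h := hS.2 x
  rw [hy] at h
  rw [h, hx]

theorem isResolventAt_opResolvent {H : B →ₗ.[ℂ] B} {z : ℂ} (hz : z ∈ opResolventSet H) :
    IsResolventAt H z (opResolvent H z) := by
  have h : ∃ R : B →L[ℂ] B, IsResolventAt H z R := hz
  rw [opResolvent, dif_pos h]
  exact h.choose_spec

/-- The Japanese bracket `⟨z⟩ = (1 + |z|²)^(1/2)`; for real `x` it is used as `⟨(x : ℂ)⟩`. -/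
def bracket (z : ℂ) : ℝ := Real.sqrt (1 + ‖z‖ ^ 2)

/-- `H` is closed and densely defined, has real spectrum, and for some `c`
`‖(z - H)⁻¹‖ ≤ c |Im z|⁻¹ (⟨z⟩ / |Im z|) ^ α` for all non-real `z`, where `α ≥ 0`. -/
structure ResolventHypothesis (H : B →ₗ.[ℂ] B) (α : ℝ) : Prop where
  closed : H.IsClosed
  dense : Dense (H.domain : Set B)
  spectrum_real : ∀ z ∈ opSpectrum H, z.im = 0
  exponent_nonneg : 0 ≤ α
  bound : ∃ c : ℝ, ∀ z : ℂ, z.im ≠ 0 →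
    ‖opResolvent H z‖ ≤ c * |z.im|⁻¹ * (bracket z / |z.im|) ^ α

end Operators

/-! ### The algebra of slowly decaying smooth functions -/

/-- `S^β`: the smooth `f : ℝ → ℂ` with `|f⁽ᵐ⁾(x)| ≤ c_m ⟨x⟩^(β - m)` for every `m`. -/
def symbolClass (β : ℝ) : Set (ℝ → ℂ) :=
  {f | ContDiff ℝ ∞ f ∧ ∀ m : ℕ, ∃ c : ℝ, 0 < c ∧
    ∀ x : ℝ, ‖iteratedDeriv m f x‖ ≤ c * bracket (x : ℂ) ^ (β - (m : ℝ))}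

/-- `𝒜 = ⋃_{β < 0} S^β`. -/
def slowAlgebra : Set (ℝ → ℂ) := ⋃ β : ℝ, ⋃ _ : β < 0, symbolClass β

/-! ### Almost analytic extensions and the functional calculus -/

/-- Admissible cut-offs: `τ` is smooth on `ℝ²`, equal to `1` where `|y| ≤ ⟨x⟩`, to `0` where
`|y| ≥ 2⟨x⟩`, and its first partial derivatives are `O(⟨x⟩⁻¹)`. This contains every
`τ(x, y) = χ(y / ⟨x⟩)` with `χ` smooth, `χ = 1` on `[-1, 1]` and `χ = 0` off `(-2, 2)`. -/
structure IsCutoff (τ : ℝ × ℝ → ℝ) : Prop where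
  smooth : ContDiff ℝ ∞ τ
  eq_one : ∀ x y : ℝ, |y| ≤ bracket (x : ℂ) → τ (x, y) = 1
  eq_zero : ∀ x y : ℝ, 2 * bracket (x : ℂ) ≤ |y| → τ (x, y) = 0
  deriv_bound : ∃ C : ℝ, ∀ x y : ℝ,
    |deriv (fun t => τ (t, y)) x| ≤ C / bracket (x : ℂ) ∧
    |deriv (fun t => τ (x, t)) y| ≤ C / bracket (x : ℂ)

/-- The almost analytic extension
`f̃(x, y) = (∑_{r=0}^n f⁽ʳ⁾(x) (iy)ʳ / r!) τ(x, y)`. -/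
def almostAnalytic (n : ℕ) (τ : ℝ × ℝ → ℝ) (f : ℝ → ℂ) (p : ℝ × ℝ) : ℂ :=
  (∑ r ∈ Finset.range (n + 1),
    iteratedDeriv r f p.1 * (Complex.I * (p.2 : ℂ)) ^ r / (r.factorial : ℂ)) * (τ p : ℂ)

/-- `∂F/∂z̄ = ½ (∂F/∂x + i ∂F/∂y)`. -/
def dbar (F : ℝ × ℝ → ℂ) (p : ℝ × ℝ) : ℂ :=
  (1 / 2 : ℂ) * (deriv (fun t : ℝ => F (t, p.2)) p.1
    + Complex.I * deriv (fun t : ℝ => F (p.1, t)) p.2)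

variable {B : Type*} [NormedAddCommGroup B] [NormedSpace ℂ B]

/-- The operator-valued integrand `(∂f̃/∂z̄)(x, y) (x + iy - H)⁻¹`. -/
def hsIntegrand (H : B →ₗ.[ℂ] B) (n : ℕ) (τ : ℝ × ℝ → ℝ) (f : ℝ → ℂ) (p : ℝ × ℝ) :
    B →L[ℂ] B :=
  dbar (almostAnalytic n τ f) p • opResolvent H ((p.1 : ℂ) + (p.2 : ℂ) * Complex.I)

/-- `f(H) = -(1/π) ∬ (∂f̃/∂z̄) (z - H)⁻¹ dx dy`, a Bochner integral in the operator norm, formed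
with the order `n` and the cut-off `τ`. -/
def hsCalculus (H : B →ₗ.[ℂ] B) (n : ℕ) (τ : ℝ × ℝ → ℝ) (f : ℝ → ℂ) : B →L[ℂ] B :=
  (-(1 / (Real.pi : ℂ))) • ∫ p : ℝ × ℝ, hsIntegrand H n τ f p

end HelfferSjostrand

end

/-!
The spectral inclusion does not need multiplicativity of the calculus. Since `σ(H)` is real, each
`s ∈ σ(H)` is a limit of points `s + iε` of the resolvent set, where the resolvent has norm at least
`1 / ε`; hence `s` is an approximate eigenvalue, with unit vectors `u_k` such that
`(H - s) u_k → 0` (`exists_norm_eq_one_norm_apply_sub_smul_le`).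

On such vectors `(z - H)⁻¹ u_k - (z - s)⁻¹ u_k = (z - s)⁻¹ (z - H)⁻¹ (H - s) u_k` tends to zero for
every non-real `z`. Integrating against `∂f̃/∂z̄` gives `f(H) u_k - f(s) u_k → 0` by dominated
convergence (`tendsto_hsCalculus_apply_sub`), so `f(s) ∈ σ(f(H))`; the closure comes for free because
the spectrum of a bounded operator is closed. Two analytic facts enter.

* Absolute convergence (`integrable_dbar_smul`). One has
  `|∂f̃/∂z̄| ≤ K ⟨x⟩^(β - 1 - n) |y|ⁿ` on the support `|y| ≤ 2⟨x⟩`, so that against the resolvent bound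
  the integrand is dominated by a multiple of `⟨x⟩^(β - 1 - n + α) |y|^(n - 1 - α)`, integrable on
  `|y| ≤ 2⟨x⟩` as `n > α` and `β < 0`.
* The scalar case `f(s) = -(1/π) ∬ (∂f̃/∂z̄) (z - s)⁻¹ dx dy`. This is the Cauchy–Pompeiu formula for
  functions vanishing at infinity (`integral_dbar_mul_inv_sub`), proved in polar coordinates about
  `s`, where `r (∂F/∂z̄) (z - s)⁻¹ = ½ (∂_r F + (i / r) ∂_θ F)`.
-/

noncomputable section

namespace HelfferSjostrand

/-! ### Resolvents and approximate eigenvectors -/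

section Operators

variable {B : Type*} [NormedAddCommGroup B] [NormedSpace ℂ B] {H : B →ₗ.[ℂ] B}

/-- Neumann series: the resolvent set contains the disc of radius `‖R‖⁻¹` about `z`. -/
theorem IsResolventAt.mem_opResolventSet_of_norm_mul_lt_one [CompleteSpace B] {z w : ℂ}
    {R : B →L[ℂ] B} (hR : IsResolventAt H z R) (h : ‖w - z‖ * ‖R‖ < 1) :
    w ∈ opResolventSet H := by
  have hA : IsUnit (1 + (w - z) • R) := by
    have h1 : ‖-((w - z) • R)‖ < 1 := by rwa [norm_neg, norm_smul]
    simpa using isUnit_one_sub_of_norm_lt_one h1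
  obtain ⟨A, hA⟩ := hA
  have hcomm : Commute (↑A⁻¹ : B →L[ℂ] B) R := by
    apply Commute.units_inv_left
    rw [hA]
    exact (Commute.one_left R).add_left ((Commute.refl R).smul_left _)
  have hAx : ∀ v : B, (A : B →L[ℂ] B) v = v + (w - z) • R v := fun v => by simp [hA]
  refine ⟨R * ↑A⁻¹, fun y => ?_, fun x => ?_⟩
  · obtain ⟨x, hx, hy⟩ := hR.1 ((↑A⁻¹ : B →L[ℂ] B) y)
    refine ⟨x, hx, ?_⟩
    have h1 : (A : B →L[ℂ] B) ((↑A⁻¹ : B →L[ℂ] B) y) = y := by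
      rw [← mul_apply_eq_comp, Units.mul_inv, one_apply_eq_self]
    rw [hAx, ← hx, ← hy] at h1
    rw [← h1]
    module
  · have h1 : R (w • (x : B) - H x) = (A : B →L[ℂ] B) x := by
      have h2 : w • (x : B) - H x = (z • (x : B) - H x) + (w - z) • (x : B) := by module
      rw [h2, map_add, hR.2 x, map_smul, hAx]
    rw [← hcomm.eq, mul_apply_eq_comp, h1, ← mul_apply_eq_comp,
      Units.inv_mul, one_apply_eq_self]

theorem one_le_norm_sub_mul_norm_opResolvent [CompleteSpace B] {z w : ℂ}
    (hz : z ∈ opResolventSet H) (hw : w ∈ opSpectrum H) :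
    1 ≤ ‖w - z‖ * ‖opResolvent H z‖ := by
  by_contra! h
  exact hw ((isResolventAt_opResolvent hz).mem_opResolventSet_of_norm_mul_lt_one h)

/-- When the spectrum is real, every spectral point is a boundary point of the resolvent set, hence
an approximate eigenvalue: normalise the vectors on which the resolvent at `s + iε` nearly attains
its norm, which is at least `1 / ε`. -/
theorem exists_norm_eq_one_norm_apply_sub_smul_le [CompleteSpace B]
    (hreal : ∀ z ∈ opSpectrum H, z.im = 0) {s : ℝ} (hs : (s : ℂ) ∈ opSpectrum H) {ε : ℝ}
    (hε : 0 < ε) : ∃ u : H.domain, ‖(u : B)‖ = 1 ∧ ‖H u - (s : ℂ) • (u : B)‖ ≤ 3 * ε := by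
  -- the spectrum being real, `s + iε` lies in the resolvent set, at distance `ε` from `s`
  set z : ℂ := s + ε * Complex.I with hz
  have hzim : z.im = ε := by simp [hz]
  have hzmem : z ∈ opResolventSet H := by
    by_contra hcon
    exact hε.ne' (hzim ▸ hreal z hcon)
  have hR := isResolventAt_opResolvent hzmem
  have hsz : ‖(s : ℂ) - z‖ = ε := by simp [hz, abs_of_pos hε]
  have h1 := one_le_norm_sub_mul_norm_opResolvent hzmem hs
  rw [hsz] at h1
  obtain ⟨v, hv⟩ : ∃ v : B, (2 * ε)⁻¹ * ‖v‖ < ‖opResolvent H z v‖ := by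
    by_contra! hcon
    have h2 := (opResolvent H z).opNorm_le_bound (by positivity) hcon
    have h3 : ε * ‖opResolvent H z‖ ≤ ε * (2 * ε)⁻¹ := by gcongr
    have h4 : ε * (2 * ε)⁻¹ = 1 / 2 := by field_simp
    linarith
  obtain ⟨x, hx, hy⟩ := hR.1 v
  rw [← hx] at hv
  have hx0 : 0 < ‖(x : B)‖ := lt_of_le_of_lt (by positivity) hv
  have hv' : ‖v‖ ≤ 2 * ε * ‖(x : B)‖ := by
    rw [inv_mul_lt_iff₀ (by positivity)] at hv
    exact hv.le
  refine ⟨((‖(x : B)‖⁻¹ : ℝ) : ℂ) • x, ?_, ?_⟩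
  · simp [norm_smul, hx0.ne']
  · have h5 : H x - (s : ℂ) • (x : B) = (z - s) • (x : B) - v := by rw [← hy]; module
    have h6 : ‖H x - (s : ℂ) • (x : B)‖ ≤ 3 * ε * ‖(x : B)‖ := by
      rw [h5]
      refine (norm_sub_le _ _).trans ?_
      rw [norm_smul, norm_sub_rev z, hsz]
      linarith
    have h7 : H (((‖(x : B)‖⁻¹ : ℝ) : ℂ) • x) - (s : ℂ) • ((((‖(x : B)‖⁻¹ : ℝ) : ℂ) • x :
        H.domain) : B) = ((‖(x : B)‖⁻¹ : ℝ) : ℂ) • (H x - (s : ℂ) • (x : B)) := by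
      rw [H.map_smul, Submodule.coe_smul]
      module
    rw [h7, norm_smul, Complex.norm_real, norm_inv, norm_norm, inv_mul_le_iff₀ hx0]
    linarith

/-- First resolvent identity. -/
theorem opResolvent_sub_opResolvent {z w : ℂ} (hz : z ∈ opResolventSet H)
    (hw : w ∈ opResolventSet H) :
    opResolvent H w - opResolvent H z = (z - w) • (opResolvent H w * opResolvent H z) := by
  ext y
  obtain ⟨x, hx, hy⟩ := (isResolventAt_opResolvent hz).1 y
  have h1 := (isResolventAt_opResolvent hw).2 x
  have h2 : y = (w • (x : B) - H x) + (z - w) • (x : B) := by rw [← hy]; module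
  have h3 : opResolvent H w y = x + (z - w) • opResolvent H w x := by
    conv_lhs => rw [h2]
    rw [map_add, h1, map_smul]
  simp [h3, ← hx]

/-- On an approximate eigenvector `u` for `s`, the operator `(z - H)⁻¹` acts nearly as the scalar
`(z - s)⁻¹`. -/
theorem opResolvent_apply_sub_inv_smul {z s : ℂ} (hz : z ∈ opResolventSet H) (hzs : z ≠ s)
    (u : H.domain) :
    opResolvent H z u - (z - s)⁻¹ • (u : B) =
      (z - s)⁻¹ • opResolvent H z (H u - s • (u : B)) := by
  have h1 := (isResolventAt_opResolvent hz).2 u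
  have h2 : H u - s • (u : B) = (z - s) • (u : B) - (z • (u : B) - H u) := by module
  rw [h2, map_sub, h1, map_smul, smul_sub, smul_smul, inv_mul_cancel₀ (sub_ne_zero.2 hzs),
    one_smul]

theorem continuous_bracket : Continuous bracket := by
  unfold bracket
  fun_prop

theorem ResolventHypothesis.mem_opResolventSet {α : ℝ} (hH : ResolventHypothesis H α) {z : ℂ}
    (hz : z.im ≠ 0) : z ∈ opResolventSet H := by
  by_contra hcon
  exact hz (hH.spectrum_real z hcon)

theorem ResolventHypothesis.continuousOn_opResolvent {α : ℝ} (hH : ResolventHypothesis H α) :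
    ContinuousOn (opResolvent H) {z | z.im ≠ 0} := by
  obtain ⟨c, hc⟩ := hH.bound
  intro z hz
  have hz' : z.im ≠ 0 := hz
  rw [ContinuousWithinAt, tendsto_iff_norm_sub_tendsto_zero]
  set g : ℂ → ℝ := fun w => c * |w.im|⁻¹ * (bracket w / |w.im|) ^ α with hg
  have hgc : ContinuousAt g z := by
    have him : ContinuousAt (fun w : ℂ => |w.im|) z := by fun_prop
    have h0 : |z.im| ≠ 0 := abs_ne_zero.2 hz'
    exact (continuousAt_const.mul (him.inv₀ h0)).mul
      ((continuous_bracket.continuousAt.div him h0).rpow_const (Or.inr hH.exponent_nonneg))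
  have hlim : Filter.Tendsto (fun w => ‖z - w‖ * (g w * ‖opResolvent H z‖))
      (nhdsWithin z {z | z.im ≠ 0}) (nhds 0) := by
    have h1 : ContinuousAt (fun w => ‖z - w‖ * (g w * ‖opResolvent H z‖)) z := by fun_prop
    have h2 := h1.tendsto
    simp only [sub_self, norm_zero, zero_mul] at h2
    exact h2.mono_left nhdsWithin_le_nhds
  refine squeeze_zero' (Filter.Eventually.of_forall fun _ => norm_nonneg _) ?_ hlim
  filter_upwards [self_mem_nhdsWithin] with w hw
  rw [opResolvent_sub_opResolvent (hH.mem_opResolventSet hz) (hH.mem_opResolventSet hw), norm_smul]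
  gcongr
  exact (norm_mul_le _ _).trans (by gcongr; exact hc w hw)

/-- A bounded operator with an approximate eigenvalue `μ` has `μ` in its spectrum. -/
theorem mem_spectrum_of_tendsto_zero {T : B →L[ℂ] B} {μ : ℂ} {u : ℕ → B}
    (hu : ∀ k, ‖u k‖ = 1)
    (hlim : Filter.Tendsto (fun k => T (u k) - μ • u k) Filter.atTop (nhds 0)) :
    μ ∈ spectrum ℂ T := by
  intro hcon
  obtain ⟨A, hA⟩ := hcon
  have h1 : ∀ k, (↑A⁻¹ : B →L[ℂ] B) (-(T (u k) - μ • u k)) = u k := fun k => by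
    have h2 : -(T (u k) - μ • u k) = (A : B →L[ℂ] B) (u k) := by
      rw [hA]
      simp [Algebra.algebraMap_eq_smul_one]
    rw [h2, ← mul_apply_eq_comp, Units.inv_mul, one_apply_eq_self]
  have h3 : Filter.Tendsto u Filter.atTop (nhds 0) := by
    have h4 := ((↑A⁻¹ : B →L[ℂ] B).continuous.tendsto _).comp hlim.neg
    simp only [neg_zero, map_zero] at h4
    exact h4.congr h1
  have h5 := h3.norm
  simp only [hu, norm_zero] at h5
  exact one_ne_zero (tendsto_nhds_unique tendsto_const_nhds h5)

end Operators

/-! ### The weight integrals -/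

theorem one_le_bracket (z : ℂ) : 1 ≤ bracket z :=
  Real.one_le_sqrt.2 (by nlinarith [sq_nonneg ‖z‖])

theorem bracket_pos (z : ℂ) : 0 < bracket z := one_pos.trans_le (one_le_bracket z)

theorem sq_bracket (z : ℂ) : bracket z ^ 2 = 1 + ‖z‖ ^ 2 :=
  Real.sq_sqrt (by positivity)

theorem norm_le_bracket (z : ℂ) : ‖z‖ ≤ bracket z :=
  Real.le_sqrt_of_sq_le (by linarith)

theorem bracket_add_mul_I_le {x y : ℝ} (h : |y| ≤ 2 * bracket (x : ℂ)) :
    bracket ((x : ℂ) + (y : ℂ) * Complex.I) ≤ 3 * bracket (x : ℂ) := by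
  have hb := bracket_pos (x : ℂ)
  have h1 : ‖(x : ℂ) + (y : ℂ) * Complex.I‖ ^ 2 = x ^ 2 + y ^ 2 := by
    rw [Complex.sq_norm, Complex.normSq_add_mul_I]
  have h2 := sq_bracket (x : ℂ)
  rw [Complex.norm_real, Real.norm_eq_abs, sq_abs] at h2
  have h3 : y ^ 2 ≤ (2 * bracket (x : ℂ)) ^ 2 := by
    rw [← sq_abs]
    gcongr
  unfold bracket at h2 h3 hb ⊢
  refine Real.sqrt_le_iff.2 ⟨by positivity, ?_⟩
  rw [h1]
  nlinarith

theorem integrable_bracket_rpow {r : ℝ} (hr : r < -1) :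
    Integrable fun x : ℝ => bracket (x : ℂ) ^ r := by
  have h1 := integrable_rpow_neg_one_add_norm_sq (E := ℝ) (μ := volume) (r := -r)
    (by simp; linarith)
  refine h1.congr (Filter.Eventually.of_forall fun x => ?_)
  simp only [bracket, Complex.norm_real, Real.sqrt_eq_rpow]
  rw [← Real.rpow_mul (by positivity)]
  congr 1
  ring

theorem integrable_ite_abs_rpow {s t : ℝ} (hs : -1 < s) (ht : t < -1) :
    Integrable fun y : ℝ => if |y| ≤ 1 then |y| ^ s else |y| ^ t := by
  have h0 : IntegrableOn (fun y : ℝ => if |y| ≤ 1 then |y| ^ s else |y| ^ t) (Set.Ioi 0) := by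
    rw [← Set.Ioc_union_Ioi_eq_Ioi zero_le_one, integrableOn_union]
    constructor
    · have h1 := (intervalIntegral.intervalIntegrable_rpow' (a := 0) (b := 1) hs).1
      refine h1.congr_fun (fun y hy => ?_) measurableSet_Ioc
      simp [abs_of_pos hy.1, hy.2]
    · refine (integrableOn_Ioi_rpow_of_lt ht one_pos).congr_fun (fun y hy => ?_) measurableSet_Ioi
      have hy' : (1 : ℝ) < y := hy
      simp [abs_of_pos (one_pos.trans hy'), hy']
  rw [← integrableOn_univ, ← Set.Iic_union_Ioi (a := (0 : ℝ)), integrableOn_union]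
  refine ⟨?_, h0⟩
  have h1 := ((Measure.measurePreserving_neg (volume : Measure ℝ)).integrableOn_comp_preimage
    (Homeomorph.neg ℝ).measurableEmbedding).2 h0
  rw [integrableOn_Iic_iff_integrableOn_Iio]
  simpa [Function.comp_def] using h1

/-- Integrability over the wedge `|y| ≤ 2⟨x⟩` of the weight `⟨x⟩^(β - 2 - s) |y|^s`, which is
homogeneous of degree `β - 2 < -2`. The weight is dominated by a product of integrable functions of
`x` and of `y`: for `|y| > 1`, part of the decay in `⟨x⟩` is traded for decay in `|y|`. -/
theorem integrable_of_norm_le_weight {E : Type*} [NormedAddCommGroup E] {G : ℝ × ℝ → E}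
    (hG : AEStronglyMeasurable G) {β s K : ℝ} (hβ : β < 0) (hs : -1 < s)
    (hzero : ∀ᵐ p : ℝ × ℝ, 2 * bracket (p.1 : ℂ) < |p.2| → G p = 0)
    (hle : ∀ᵐ p : ℝ × ℝ, |p.2| ≤ 2 * bracket (p.1 : ℂ) →
      ‖G p‖ ≤ K * bracket (p.1 : ℂ) ^ (β - 2 - s) * |p.2| ^ s) :
    Integrable G := by
  have hprod := ((integrable_bracket_rpow (r := -1 + β / 2) (by linarith)).mul_prod
    (integrable_ite_abs_rpow (t := -1 + β / 2) hs (by linarith))).const_mul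
      (|K| * 2 ^ (1 + s - β / 2))
  refine hprod.mono' hG ?_
  filter_upwards [hzero, hle] with p hp0 hp1
  set b := bracket (p.1 : ℂ) with hb
  have hb1 : 1 ≤ b := one_le_bracket _
  have hb0 : 0 < b := bracket_pos _
  rcases lt_or_ge (2 * b) |p.2| with h | h
  · rw [hp0 h, norm_zero]
    have : 0 ≤ if |p.2| ≤ 1 then |p.2| ^ s else |p.2| ^ (-1 + β / 2) := by
      split_ifs <;> positivity
    positivity
  refine (hp1 h).trans ?_
  have hsplit : b ^ (β - 2 - s) = b ^ (-1 + β / 2) * b ^ (-(1 + s - β / 2)) := by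
    rw [← Real.rpow_add hb0]
    congr 1
    ring
  have hexp : 0 ≤ 1 + s - β / 2 := by linarith
  have h2 : (1 : ℝ) ≤ 2 ^ (1 + s - β / 2) := Real.one_le_rpow one_le_two hexp
  have hKle : K * b ^ (β - 2 - s) * |p.2| ^ s ≤ |K| * b ^ (β - 2 - s) * |p.2| ^ s := by
    gcongr
    exact le_abs_self K
  refine hKle.trans ?_
  rw [hsplit]
  split_ifs with hy
  · have h3 : b ^ (-(1 + s - β / 2)) ≤ 1 := Real.rpow_le_one_of_one_le_of_nonpos hb1 (by linarith)
    calc |K| * (b ^ (-1 + β / 2) * b ^ (-(1 + s - β / 2))) * |p.2| ^ s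
        ≤ |K| * (b ^ (-1 + β / 2) * 2 ^ (1 + s - β / 2)) * |p.2| ^ s := by
          gcongr
          exact h3.trans h2
      _ = _ := by ring
  · have hy0 : 0 < |p.2| := by linarith
    have h3 : b ^ (-(1 + s - β / 2)) ≤ 2 ^ (1 + s - β / 2) * |p.2| ^ (-(1 + s - β / 2)) := by
      have h4 : b ^ (-(1 + s - β / 2)) ≤ (|p.2| / 2) ^ (-(1 + s - β / 2)) :=
        Real.rpow_le_rpow_of_nonpos (by positivity) (by linarith) (by linarith)
      refine h4.trans_eq ?_
      rw [Real.div_rpow hy0.le zero_le_two, Real.rpow_neg zero_le_two, div_inv_eq_mul, mul_comm]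
    have h5 : |p.2| ^ (-1 + β / 2) = |p.2| ^ (-(1 + s - β / 2)) * |p.2| ^ s := by
      rw [← Real.rpow_add hy0]
      congr 1
      ring
    rw [h5]
    calc |K| * (b ^ (-1 + β / 2) * b ^ (-(1 + s - β / 2))) * |p.2| ^ s
        ≤ |K| * (b ^ (-1 + β / 2) * (2 ^ (1 + s - β / 2) * |p.2| ^ (-(1 + s - β / 2)))) *
          |p.2| ^ s := by gcongr
      _ = _ := by ring

theorem ae_snd_ne_zero : ∀ᵐ p : ℝ × ℝ, p.2 ≠ 0 :=
  Measure.quasiMeasurePreserving_snd.ae (Measure.ae_ne volume (0 : ℝ))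

/-! ### Bounds for almost analytic extensions -/

/-- Only the derivatives of a cut-off are assumed bounded; since `τ = 1` on the real axis, the mean
value inequality in `y` bounds `τ` itself where `|y| ≤ 2⟨x⟩`, outside of which it vanishes. -/
theorem IsCutoff.abs_le {τ : ℝ × ℝ → ℝ} (hτ : IsCutoff τ) :
    ∃ M : ℝ, 0 ≤ M ∧ ∀ x y : ℝ, |y| ≤ 2 * bracket (x : ℂ) → |τ (x, y)| ≤ M := by
  obtain ⟨C, hC⟩ := hτ.deriv_bound
  refine ⟨1 + 2 * |C|, by positivity, fun x y hy => ?_⟩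
  have hb := bracket_pos (x : ℂ)
  have hdiff : Differentiable ℝ fun t => τ (x, t) :=
    (hτ.smooth.differentiable (by simp)).comp (by fun_prop)
  have h1 := Convex.norm_image_sub_le_of_norm_deriv_le (f := fun t => τ (x, t)) (s := Set.univ)
    (x := 0) (y := y) (C := |C| / bracket (x : ℂ)) (fun t _ => hdiff t)
    (fun t _ => ((hC x t).2).trans (by gcongr; exact le_abs_self C)) convex_univ
    (Set.mem_univ _) (Set.mem_univ _)
  have h2 : τ (x, 0) = 1 := hτ.eq_one x 0 (by simpa using hb.le)
  simp only [h2, Real.norm_eq_abs, sub_zero] at h1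
  have h3 : |C| / bracket (x : ℂ) * |y| ≤ 2 * |C| := by
    rw [div_mul_eq_mul_div, div_le_iff₀ hb]
    nlinarith [abs_nonneg C]
  have h4 : |τ (x, y)| ≤ |τ (x, y) - 1| + 1 := by
    simpa using abs_add_le (τ (x, y) - 1) 1
  linarith

/-- The Taylor part `∑_{r=0}^n f⁽ʳ⁾(x) (iy)ʳ / r!` of the almost analytic extension. -/
def taylorPart (n : ℕ) (f : ℝ → ℂ) (x y : ℝ) : ℂ :=
  ∑ r ∈ Finset.range (n + 1), iteratedDeriv r f x * (Complex.I * (y : ℂ)) ^ r / (r.factorial : ℂ)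

theorem hasDerivAt_taylorPart_fst {f : ℝ → ℂ} (hf : ContDiff ℝ ∞ f) (n : ℕ) (x y : ℝ) :
    HasDerivAt (fun t => taylorPart n f t y) (∑ r ∈ Finset.range (n + 1),
      iteratedDeriv (r + 1) f x * (Complex.I * (y : ℂ)) ^ r / (r.factorial : ℂ)) x := by
  refine HasDerivAt.fun_sum fun r _ => HasDerivAt.div_const (HasDerivAt.mul_const ?_ _) _
  rw [iteratedDeriv_succ]
  exact ((hf.differentiable_iteratedDeriv r (by exact_mod_cast ENat.natCast_lt_top r)) x).hasDerivAt

theorem hasDerivAt_taylorPart_snd (f : ℝ → ℂ) (n : ℕ) (x y : ℝ) :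
    HasDerivAt (fun t => taylorPart n f x t) (Complex.I * ∑ r ∈ Finset.range n,
      iteratedDeriv (r + 1) f x * (Complex.I * (y : ℂ)) ^ r / (r.factorial : ℂ)) y := by
  have hlin : HasDerivAt (fun t : ℝ => Complex.I * (t : ℂ)) Complex.I y := by
    simpa using (Complex.ofRealCLM.hasDerivAt (x := y)).const_mul Complex.I
  have h1 : HasDerivAt (fun t => taylorPart n f x t) (∑ r ∈ Finset.range (n + 1),
      iteratedDeriv r f x * (r * (Complex.I * (y : ℂ)) ^ (r - 1) * Complex.I) /
        (r.factorial : ℂ)) y :=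
    HasDerivAt.fun_sum fun r _ => HasDerivAt.div_const ((hlin.fun_pow r).const_mul _) _
  convert h1 using 1
  rw [Finset.sum_range_succ', Finset.mul_sum]
  simp only [Nat.cast_zero, zero_mul, mul_zero, zero_div, add_zero, Nat.add_sub_cancel]
  refine Finset.sum_congr rfl fun r _ => ?_
  have h2 : ((r : ℂ) + 1) ≠ 0 := by exact_mod_cast Nat.succ_ne_zero r
  have h3 : (r.factorial : ℂ) ≠ 0 := by exact_mod_cast Nat.factorial_ne_zero r
  rw [Nat.factorial_succ]
  push_cast
  field_simp

/-- The Taylor sums telescope in `∂/∂z̄`: what survives is the top-order term, which vanishes to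
order `n` on the real axis, and a term carrying the derivatives of the cut-off. -/
theorem dbar_almostAnalytic {f : ℝ → ℂ} (hf : ContDiff ℝ ∞ f) {τ : ℝ × ℝ → ℝ} (hτ : IsCutoff τ)
    (n : ℕ) (x y : ℝ) :
    dbar (almostAnalytic n τ f) (x, y) = (1 / 2 : ℂ) *
      (iteratedDeriv (n + 1) f x * (Complex.I * (y : ℂ)) ^ n / (n.factorial : ℂ) * (τ (x, y) : ℂ)
        + taylorPart n f x y * ((deriv (fun t => τ (t, y)) x : ℝ)
          + Complex.I * (deriv (fun t => τ (x, t)) y : ℝ))) := by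
  have hd := hτ.smooth.differentiable (by simp)
  have hx : DifferentiableAt ℝ (fun t => τ (t, y)) x := hd.comp (by fun_prop) x
  have hy : DifferentiableAt ℝ (fun t => τ (x, t)) y := hd.comp (by fun_prop) y
  have h1 := ((hasDerivAt_taylorPart_fst hf n x y).mul hx.hasDerivAt.ofReal_comp).deriv
  have h2 := ((hasDerivAt_taylorPart_snd f n x y).mul hy.hasDerivAt.ofReal_comp).deriv
  have h3 : deriv (fun t : ℝ => almostAnalytic n τ f (t, y)) x = _ := h1
  have h4 : deriv (fun t : ℝ => almostAnalytic n τ f (x, t)) y = _ := h2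
  simp only [dbar]
  rw [h3, h4, Finset.sum_range_succ]
  linear_combination (1 / 2 : ℂ) * (τ (x, y) : ℂ) * (∑ r ∈ Finset.range n,
    iteratedDeriv (r + 1) f x * (Complex.I * (y : ℂ)) ^ r / (r.factorial : ℂ)) * Complex.I_sq

theorem contDiff_almostAnalytic {f : ℝ → ℂ} (hf : ContDiff ℝ ∞ f) {τ : ℝ × ℝ → ℝ}
    (hτ : IsCutoff τ) (n : ℕ) : ContDiff ℝ ∞ (almostAnalytic n τ f) := by
  have h1 : ∀ r : ℕ, ContDiff ℝ ∞ (iteratedDeriv r f) := fun r => by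
    rw [iteratedDeriv_eq_iterate]
    exact hf.iterate_deriv r
  have h2 := hτ.smooth
  unfold almostAnalytic
  refine ContDiff.mul (ContDiff.sum fun r _ => ?_) (Complex.ofRealCLM.contDiff.comp h2)
  refine ContDiff.div_const (ContDiff.mul ((h1 r).comp contDiff_fst) (ContDiff.pow ?_ r)) _
  exact contDiff_const.mul (Complex.ofRealCLM.contDiff.comp contDiff_snd)

theorem norm_iteratedDeriv_mul_pow_le {f : ℝ → ℂ} {β : ℝ} {m r : ℕ} {c : ℝ} {x : ℝ} (y : ℝ)
    (hc : ‖iteratedDeriv m f x‖ ≤ c * bracket (x : ℂ) ^ (β - (m : ℝ))) :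
    ‖iteratedDeriv m f x * (Complex.I * (y : ℂ)) ^ r / (r.factorial : ℂ)‖ ≤
      c * bracket (x : ℂ) ^ (β - (m : ℝ)) * |y| ^ r := by
  have h1 : (1 : ℝ) ≤ r.factorial := by exact_mod_cast Nat.one_le_iff_ne_zero.2 r.factorial_ne_zero
  have h0 : ‖iteratedDeriv m f x * (Complex.I * (y : ℂ)) ^ r‖ ≤
      c * bracket (x : ℂ) ^ (β - (m : ℝ)) * |y| ^ r := by
    rw [norm_mul, norm_pow, norm_mul, Complex.norm_I, one_mul, Complex.norm_real,
      Real.norm_eq_abs]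
    gcongr
  rw [norm_div, Complex.norm_natCast]
  exact (div_le_self (norm_nonneg _) h1).trans h0

theorem rpow_sub_natCast_mul_pow {b y β : ℝ} (hb : 0 < b) (r : ℕ) :
    b ^ (β - (r : ℝ)) * y ^ r = b ^ β * (y / b) ^ r := by
  rw [Real.rpow_sub hb, Real.rpow_natCast, div_pow]
  ring

theorem exists_norm_taylorPart_le {f : ℝ → ℂ} {β : ℝ} (hf : f ∈ symbolClass β) (n : ℕ) :
    ∃ K : ℝ, 0 ≤ K ∧ ∀ x y : ℝ, ‖taylorPart n f x y‖ ≤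
      K * bracket (x : ℂ) ^ β * (max 1 (|y| / bracket (x : ℂ))) ^ n := by
  choose c hc0 hc using hf.2
  refine ⟨∑ r ∈ Finset.range (n + 1), c r, Finset.sum_nonneg fun r _ => (hc0 r).le,
    fun x y => ?_⟩
  have hb := bracket_pos (x : ℂ)
  unfold taylorPart
  rw [Finset.sum_mul, Finset.sum_mul]
  refine norm_sum_le_of_le _ fun r hr => ?_
  refine (norm_iteratedDeriv_mul_pow_le y (hc r x)).trans ?_
  rw [mul_assoc, rpow_sub_natCast_mul_pow hb, ← mul_assoc]
  have := (hc0 r).le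
  gcongr
  calc (|y| / bracket (x : ℂ)) ^ r ≤ (max 1 (|y| / bracket (x : ℂ))) ^ r := by
        gcongr
        exact le_max_right _ _
    _ ≤ _ := pow_le_pow_right₀ (le_max_left _ _) (Finset.mem_range_succ_iff.1 hr)

theorem exists_norm_almostAnalytic_le {f : ℝ → ℂ} {β : ℝ} (hf : f ∈ symbolClass β)
    {τ : ℝ × ℝ → ℝ} (hτ : IsCutoff τ) (n : ℕ) :
    ∃ K : ℝ, 0 ≤ K ∧ ∀ x y : ℝ, |y| ≤ 2 * bracket (x : ℂ) →
      ‖almostAnalytic n τ f (x, y)‖ ≤ K * bracket (x : ℂ) ^ β := by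
  obtain ⟨K, hK0, hK⟩ := exists_norm_taylorPart_le hf n
  obtain ⟨M, hM0, hM⟩ := hτ.abs_le
  refine ⟨K * 2 ^ n * M, by positivity, fun x y hy => ?_⟩
  have hb := bracket_pos (x : ℂ)
  have h1 : max 1 (|y| / bracket (x : ℂ)) ≤ 2 :=
    max_le one_le_two ((div_le_iff₀ hb).2 hy)
  have h2 : almostAnalytic n τ f (x, y) = taylorPart n f x y * (τ (x, y) : ℂ) := rfl
  rw [h2, norm_mul, Complex.norm_real, Real.norm_eq_abs]
  calc ‖taylorPart n f x y‖ * |τ (x, y)|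
      ≤ (K * bracket (x : ℂ) ^ β * 2 ^ n) * M := by
        gcongr
        · exact (hK x y).trans (by gcongr)
        · exact hM x y hy
    _ = _ := by ring

theorem almostAnalytic_eq_zero {f : ℝ → ℂ} {τ : ℝ × ℝ → ℝ} (hτ : IsCutoff τ) (n : ℕ) {x y : ℝ}
    (h : 2 * bracket (x : ℂ) ≤ |y|) : almostAnalytic n τ f (x, y) = 0 := by
  simp [almostAnalytic, hτ.eq_zero x y h]

theorem tendsto_almostAnalytic_cocompact {f : ℝ → ℂ} {β : ℝ} (hβ : β < 0)
    (hf : f ∈ symbolClass β) {τ : ℝ × ℝ → ℝ} (hτ : IsCutoff τ) (n : ℕ) :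
    Filter.Tendsto (almostAnalytic n τ f) (Filter.cocompact (ℝ × ℝ)) (nhds 0) := by
  obtain ⟨K, hK0, hK⟩ := exists_norm_almostAnalytic_le hf hτ n
  have hn : Filter.Tendsto (fun p : ℝ × ℝ => ‖p‖) (Filter.cocompact (ℝ × ℝ)) Filter.atTop :=
    tendsto_norm_cocompact_atTop
  have hlim : Filter.Tendsto (fun p : ℝ × ℝ => K * (‖p‖ / 2) ^ β) (Filter.cocompact (ℝ × ℝ))
      (nhds 0) := by
    have h1 := tendsto_rpow_neg_atTop (neg_pos.2 hβ)
    rw [neg_neg] at h1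
    simpa using (h1.comp (hn.atTop_div_const two_pos)).const_mul K
  refine squeeze_zero_norm' ?_ hlim
  filter_upwards [hn.eventually_gt_atTop 0] with p hp
  rcases le_total (2 * bracket (p.1 : ℂ)) |p.2| with h | h
  · rw [show p = (p.1, p.2) from rfl, almostAnalytic_eq_zero hτ n h, norm_zero]
    positivity
  · refine (hK p.1 p.2 h).trans (mul_le_mul_of_nonneg_left ?_ hK0)
    have h1 : ‖p‖ ≤ 2 * bracket (p.1 : ℂ) := by
      rw [Prod.norm_def]
      refine max_le ?_ h
      have h2 := norm_le_bracket (p.1 : ℂ)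
      rw [Complex.norm_real] at h2
      linarith [bracket_pos (p.1 : ℂ)]
    exact Real.rpow_le_rpow_of_nonpos (half_pos hp) (by linarith) hβ.le

theorem IsCutoff.deriv_eq_zero_of_abs_lt {τ : ℝ × ℝ → ℝ} (hτ : IsCutoff τ) {x y : ℝ}
    (h : |y| < bracket (x : ℂ)) :
    deriv (fun t => τ (t, y)) x = 0 ∧ deriv (fun t => τ (x, t)) y = 0 := by
  have hc : Continuous fun t : ℝ => bracket (t : ℂ) :=
    continuous_bracket.comp Complex.continuous_ofReal
  constructor
  · have h1 : (fun t => τ (t, y)) =ᶠ[nhds x] fun _ => 1 := by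
      filter_upwards [hc.continuousAt.eventually (lt_mem_nhds h)] with t ht
      exact hτ.eq_one t y ht.le
    rw [h1.deriv_eq, deriv_const]
  · have h1 : (fun t => τ (x, t)) =ᶠ[nhds y] fun _ => 1 := by
      filter_upwards [continuous_abs.continuousAt.eventually (gt_mem_nhds h)] with t ht
      exact hτ.eq_one x t ht.le
    rw [h1.deriv_eq, deriv_const]

theorem IsCutoff.deriv_eq_zero_of_lt_abs {τ : ℝ × ℝ → ℝ} (hτ : IsCutoff τ) {x y : ℝ}
    (h : 2 * bracket (x : ℂ) < |y|) :
    deriv (fun t => τ (t, y)) x = 0 ∧ deriv (fun t => τ (x, t)) y = 0 := by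
  have hc : Continuous fun t : ℝ => 2 * bracket (t : ℂ) :=
    continuous_const.mul (continuous_bracket.comp Complex.continuous_ofReal)
  constructor
  · have h1 : (fun t => τ (t, y)) =ᶠ[nhds x] fun _ => 0 := by
      filter_upwards [hc.continuousAt.eventually (gt_mem_nhds h)] with t ht
      exact hτ.eq_zero t y ht.le
    rw [h1.deriv_eq, deriv_const]
  · have h1 : (fun t => τ (x, t)) =ᶠ[nhds y] fun _ => 0 := by
      filter_upwards [continuous_abs.continuousAt.eventually (lt_mem_nhds h)] with t ht
      exact hτ.eq_zero x t ht.le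
    rw [h1.deriv_eq, deriv_const]

theorem dbar_almostAnalytic_eq_zero {f : ℝ → ℂ} (hf : ContDiff ℝ ∞ f) {τ : ℝ × ℝ → ℝ}
    (hτ : IsCutoff τ) (n : ℕ) {x y : ℝ} (h : 2 * bracket (x : ℂ) < |y|) :
    dbar (almostAnalytic n τ f) (x, y) = 0 := by
  rw [dbar_almostAnalytic hf hτ, hτ.eq_zero x y h.le, (hτ.deriv_eq_zero_of_lt_abs h).1,
    (hτ.deriv_eq_zero_of_lt_abs h).2]
  simp

/-- The term of `∂f̃/∂z̄` carrying the derivatives of the cut-off lives where `|y| ≥ ⟨x⟩`, so there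
each `(|y| / ⟨x⟩)ʳ` with `r ≤ n` is at most `(|y| / ⟨x⟩)ⁿ` and it obeys the same bound as the
top-order term. -/
theorem exists_norm_dbar_almostAnalytic_le {f : ℝ → ℂ} {β : ℝ} (hf : f ∈ symbolClass β)
    {τ : ℝ × ℝ → ℝ} (hτ : IsCutoff τ) (n : ℕ) :
    ∃ K : ℝ, 0 ≤ K ∧ ∀ x y : ℝ, |y| ≤ 2 * bracket (x : ℂ) →
      ‖dbar (almostAnalytic n τ f) (x, y)‖ ≤
        K * bracket (x : ℂ) ^ (β - 1 - (n : ℝ)) * |y| ^ n := by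
  obtain ⟨K, hK0, hK⟩ := exists_norm_taylorPart_le hf n
  obtain ⟨M, hM0, hM⟩ := hτ.abs_le
  obtain ⟨C, hC⟩ := hτ.deriv_bound
  obtain ⟨c, hc0, hc⟩ := hf.2 (n + 1)
  refine ⟨c * M + K * (2 * |C|), by positivity, fun x y hy => ?_⟩
  have hb := bracket_pos (x : ℂ)
  set b := bracket (x : ℂ) with hbdef
  have htop : ‖iteratedDeriv (n + 1) f x * (Complex.I * (y : ℂ)) ^ n / (n.factorial : ℂ)
      * (τ (x, y) : ℂ)‖ ≤ c * M * b ^ (β - 1 - (n : ℝ)) * |y| ^ n := by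
    rw [norm_mul, Complex.norm_real, Real.norm_eq_abs]
    have h1 := norm_iteratedDeriv_mul_pow_le (r := n) y (hc x)
    have h2 : β - ((n + 1 : ℕ) : ℝ) = β - 1 - n := by push_cast; ring
    rw [h2] at h1
    calc _ ≤ c * b ^ (β - 1 - (n : ℝ)) * |y| ^ n * M := by
          gcongr
          exact hM x y hy
      _ = _ := by ring
  have hcut : ‖taylorPart n f x y * ((deriv (fun t => τ (t, y)) x : ℝ)
      + Complex.I * (deriv (fun t => τ (x, t)) y : ℝ))‖ ≤
      K * (2 * |C|) * b ^ (β - 1 - (n : ℝ)) * |y| ^ n := by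
    rcases lt_or_ge |y| b with h | h
    · rw [(hτ.deriv_eq_zero_of_abs_lt h).1, (hτ.deriv_eq_zero_of_abs_lt h).2]
      simp only [Complex.ofReal_zero, mul_zero, add_zero, norm_zero]
      positivity
    · have h1 : ‖((deriv (fun t => τ (t, y)) x : ℝ) : ℂ)
          + Complex.I * (deriv (fun t => τ (x, t)) y : ℝ)‖ ≤ 2 * |C| / b := by
        refine (norm_add_le _ _).trans ?_
        rw [norm_mul, Complex.norm_I, one_mul, Complex.norm_real, Complex.norm_real,
          Real.norm_eq_abs, Real.norm_eq_abs]
        have h2 : C / b ≤ |C| / b := by gcongr; exact le_abs_self C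
        have h3 : 2 * |C| / b = |C| / b + |C| / b := by ring
        rw [h3]
        exact add_le_add ((hC x y).1.trans h2) ((hC x y).2.trans h2)
      have h4 := hK x y
      rw [← hbdef, max_eq_right ((one_le_div hb).2 h)] at h4
      have h5 : b ^ (β - 1 - (n : ℝ)) = b ^ β / b / b ^ n := by
        rw [Real.rpow_sub hb, Real.rpow_sub hb, Real.rpow_one, Real.rpow_natCast]
      rw [norm_mul]
      calc _ ≤ (K * b ^ β * (|y| / b) ^ n) * (2 * |C| / b) := by gcongr
        _ = _ := by rw [h5, div_pow]; field_simp
  rw [dbar_almostAnalytic hf.1 hτ, norm_mul]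
  have h6 := norm_add_le (iteratedDeriv (n + 1) f x * (Complex.I * (y : ℂ)) ^ n /
    (n.factorial : ℂ) * (τ (x, y) : ℂ)) (taylorPart n f x y * ((deriv (fun t => τ (t, y)) x : ℝ)
      + Complex.I * (deriv (fun t => τ (x, t)) y : ℝ)))
  have h7 : ‖(1 / 2 : ℂ)‖ ≤ 1 := by norm_num
  calc _ ≤ 1 * (c * M * b ^ (β - 1 - (n : ℝ)) * |y| ^ n
        + K * (2 * |C|) * b ^ (β - 1 - (n : ℝ)) * |y| ^ n) := by
        gcongr
        exact h6.trans (add_le_add htop hcut)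
    _ = _ := by ring

theorem dbar_eq_fderiv {F : ℝ × ℝ → ℂ} (hF : Differentiable ℝ F) (p : ℝ × ℝ) :
    dbar F p = (1 / 2 : ℂ) * (fderiv ℝ F p (1, 0) + Complex.I * fderiv ℝ F p (0, 1)) := by
  have h1 : HasDerivAt (fun t : ℝ => F (t, p.2)) (fderiv ℝ F p (1, 0)) p.1 :=
    (hF p).hasFDerivAt.comp_hasDerivAt p.1
      ((hasDerivAt_id p.1).prodMk (hasDerivAt_const p.1 p.2))
  have h2 : HasDerivAt (fun t : ℝ => F (p.1, t)) (fderiv ℝ F p (0, 1)) p.2 :=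
    (hF p).hasFDerivAt.comp_hasDerivAt p.2
      ((hasDerivAt_const p.2 p.1).prodMk (hasDerivAt_id p.2))
  rw [dbar, h1.deriv, h2.deriv]

theorem continuous_dbar {F : ℝ × ℝ → ℂ} (hF : ContDiff ℝ 1 F) : Continuous (dbar F) := by
  have h1 := hF.continuous_fderiv one_ne_zero
  have h2 : dbar F = fun p => (1 / 2 : ℂ) *
      (fderiv ℝ F p (1, 0) + Complex.I * fderiv ℝ F p (0, 1)) :=
    funext fun p => dbar_eq_fderiv (hF.differentiable one_ne_zero) p
  rw [h2]
  fun_prop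

/-- Absolute convergence of the Helffer–Sjöstrand integral against any operator-valued (or
scalar) kernel satisfying the resolvent bound: the order `n > α` of vanishing of `∂f̃/∂z̄` on the
real axis makes the singularity `|y|^(n - 1 - α)` integrable. -/
theorem integrable_dbar_smul {E : Type*} [NormedAddCommGroup E] [NormedSpace ℂ E]
    {f : ℝ → ℂ} (hf : f ∈ slowAlgebra) {τ : ℝ × ℝ → ℝ} (hτ : IsCutoff τ) {n : ℕ} {α c : ℝ}
    (hα : 0 ≤ α) (hn : α < (n : ℝ)) {G : ℂ → E} (hGc : ContinuousOn G {z | z.im ≠ 0})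
    (hG : ∀ z : ℂ, z.im ≠ 0 → ‖G z‖ ≤ c * |z.im|⁻¹ * (bracket z / |z.im|) ^ α) :
    Integrable fun p : ℝ × ℝ =>
      dbar (almostAnalytic n τ f) p • G ((p.1 : ℂ) + (p.2 : ℂ) * Complex.I) := by
  obtain ⟨β, hβ, hf⟩ : ∃ β : ℝ, β < 0 ∧ f ∈ symbolClass β := by
    simpa [slowAlgebra] using hf
  obtain ⟨K, hK0, hK⟩ := exists_norm_dbar_almostAnalytic_le hf hτ n
  have hcont : Continuous (dbar (almostAnalytic n τ f)) :=
    continuous_dbar ((contDiff_almostAnalytic hf.1 hτ n).of_le (by exact_mod_cast le_top))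
  -- the kernel is controlled only off the real axis, which is a null set
  have hmeas : AEStronglyMeasurable fun p : ℝ × ℝ =>
      dbar (almostAnalytic n τ f) p • G ((p.1 : ℂ) + (p.2 : ℂ) * Complex.I) := by
    have hset : MeasurableSet {p : ℝ × ℝ | p.2 ≠ 0} :=
      (isOpen_ne_fun continuous_snd continuous_const).measurableSet
    have hrestr : (volume : Measure (ℝ × ℝ)).restrict {p | p.2 ≠ 0} = volume :=
      Measure.restrict_eq_self_of_ae_mem ae_snd_ne_zero
    rw [← hrestr]
    refine ContinuousOn.aestronglyMeasurable (hcont.continuousOn.smul ?_) hset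
    exact hGc.comp (by fun_prop) fun p hp => by simpa using hp
  refine integrable_of_norm_le_weight (s := n - 1 - α) (K := K * (|c| * 3 ^ α)) hmeas hβ
    (by linarith) (Filter.Eventually.of_forall fun p hp => ?_) ?_
  · rw [show p = (p.1, p.2) from rfl, dbar_almostAnalytic_eq_zero hf.1 hτ n hp, zero_smul]
  filter_upwards [ae_snd_ne_zero] with p hp0 hp
  set b := bracket (p.1 : ℂ) with hbdef
  have hb : 0 < b := bracket_pos _
  have hy : 0 < |p.2| := abs_pos.2 hp0
  have him : ((p.1 : ℂ) + (p.2 : ℂ) * Complex.I).im = p.2 := by simp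
  have h1 := hG ((p.1 : ℂ) + (p.2 : ℂ) * Complex.I) (by rwa [him])
  rw [him] at h1
  have h2 : ‖G ((p.1 : ℂ) + (p.2 : ℂ) * Complex.I)‖ ≤
      |c| * |p.2|⁻¹ * (3 * b / |p.2|) ^ α := by
    refine h1.trans ?_
    have hbz := bracket_pos ((p.1 : ℂ) + (p.2 : ℂ) * Complex.I)
    gcongr
    · exact le_abs_self c
    · exact bracket_add_mul_I_le hp
  rw [norm_smul]
  calc _ ≤ (K * b ^ (β - 1 - (n : ℝ)) * |p.2| ^ n) * (|c| * |p.2|⁻¹ * (3 * b / |p.2|) ^ α) := by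
        gcongr
        exact hK p.1 p.2 hp
    _ = _ := by
        have h3 : b ^ (β - 2 - (n - 1 - α)) = b ^ (β - 1 - (n : ℝ)) * b ^ α := by
          rw [← Real.rpow_add hb]
          congr 1
          ring
        have h4 : |p.2| ^ ((n : ℝ) - 1 - α) = |p.2| ^ n / |p.2| / |p.2| ^ α := by
          rw [Real.rpow_sub hy, Real.rpow_sub hy, Real.rpow_one, Real.rpow_natCast]
        rw [h3, h4, Real.div_rpow (by positivity) hy.le, Real.mul_rpow (by norm_num) hb.le]
        field_simp

/-! ### The Cauchy–Pompeiu formula on the plane -/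

/-- In polar coordinates the integrand of the Cauchy–Pompeiu formula is the sum of the radial
derivative and `i / r` times the angular derivative of `F`, up to the factor `1 / 2`. -/
theorem smul_dbar_mul_inv_polar {F : ℝ × ℝ → ℂ} (hF : Differentiable ℝ F) (p : ℝ × ℝ) {r : ℝ}
    (hr : r ≠ 0) (θ : ℝ) :
    r • (dbar F p * (((r * Real.cos θ : ℝ) : ℂ) + ((r * Real.sin θ : ℝ) : ℂ) * Complex.I)⁻¹) =
      (1 / 2 : ℂ) * (fderiv ℝ F p (Real.cos θ, Real.sin θ)
        + Complex.I * fderiv ℝ F p (-Real.sin θ, Real.cos θ)) := by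
  have hlin : ∀ a b : ℝ, fderiv ℝ F p (a, b) =
      (a : ℂ) * fderiv ℝ F p (1, 0) + (b : ℂ) * fderiv ℝ F p (0, 1) := fun a b => by
    have h1 : ((a, b) : ℝ × ℝ) = a • ((1, 0) : ℝ × ℝ) + b • ((0, 1) : ℝ × ℝ) := by simp
    rw [h1, map_add, map_smul, map_smul, Complex.real_smul, Complex.real_smul]
  have hsq : (Real.cos θ : ℂ) ^ 2 + (Real.sin θ : ℂ) ^ 2 = 1 := by
    exact_mod_cast Real.cos_sq_add_sin_sq θ
  have hr' : (r : ℂ) ≠ 0 := by exact_mod_cast hr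
  have hinv : (((r * Real.cos θ : ℝ) : ℂ) + ((r * Real.sin θ : ℝ) : ℂ) * Complex.I)⁻¹ =
      (r : ℂ)⁻¹ * ((Real.cos θ : ℂ) - (Real.sin θ : ℂ) * Complex.I) := by
    refine inv_eq_of_mul_eq_one_left ?_
    push_cast
    rw [Complex.ofReal_cos, Complex.ofReal_sin] at hsq
    field_simp
    linear_combination hsq - Complex.sin θ ^ 2 * Complex.I_sq
  rw [dbar_eq_fderiv hF, hinv, hlin (Real.cos θ), hlin (-Real.sin θ), Complex.real_smul]
  push_cast
  field_simp
  linear_combination (-fderiv ℝ F p (0, 1) * Complex.sin θ) * Complex.I_sq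

/-- The point at polar coordinates `(r, θ)` about the centre `c`. -/
def polarPoint (c : ℝ × ℝ) (r θ : ℝ) : ℝ × ℝ := c + (r * Real.cos θ, r * Real.sin θ)

theorem hasDerivAt_polarPoint_radial {F : ℝ × ℝ → ℂ} (hF : Differentiable ℝ F) (c : ℝ × ℝ)
    (r θ : ℝ) : HasDerivAt (fun t => F (polarPoint c t θ))
      (fderiv ℝ F (polarPoint c r θ) (Real.cos θ, Real.sin θ)) r := by
  refine (hF _).hasFDerivAt.comp_hasDerivAt r ?_
  refine HasDerivAt.const_add c (HasDerivAt.prodMk ?_ ?_)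
  · simpa using (hasDerivAt_id r).mul_const (Real.cos θ)
  · simpa using (hasDerivAt_id r).mul_const (Real.sin θ)

theorem hasDerivAt_polarPoint_angular {F : ℝ × ℝ → ℂ} (hF : Differentiable ℝ F) (c : ℝ × ℝ)
    (r θ : ℝ) : HasDerivAt (fun t => F (polarPoint c r t))
      (r • fderiv ℝ F (polarPoint c r θ) (-Real.sin θ, Real.cos θ)) θ := by
  rw [← map_smul]
  refine (hF _).hasFDerivAt.comp_hasDerivAt θ ?_
  exact HasDerivAt.const_add c
    (((Real.hasDerivAt_cos θ).const_mul r).prodMk ((Real.hasDerivAt_sin θ).const_mul r))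

theorem continuous_polarPoint (c : ℝ × ℝ) :
    Continuous fun q : ℝ × ℝ => polarPoint c q.1 q.2 := by
  unfold polarPoint
  fun_prop

/-- The Cauchy–Pompeiu integral over the part `0 < r ≤ R` of the plane in polar coordinates: the
radial derivative integrates to the boundary values, the angular one to zero by periodicity. -/
theorem setIntegral_polar_fderiv {F : ℝ × ℝ → ℂ} (hF : ContDiff ℝ 1 F) (c : ℝ × ℝ) {R : ℝ}
    (hR : 0 ≤ R) :
    ∫ q in Set.Ioc 0 R ×ˢ Set.Ioc (-Real.pi) Real.pi, (1 / 2 : ℂ) *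
      (fderiv ℝ F (polarPoint c q.1 q.2) (Real.cos q.2, Real.sin q.2)
        + Complex.I * fderiv ℝ F (polarPoint c q.1 q.2) (-Real.sin q.2, Real.cos q.2)) =
      (1 / 2 : ℂ) * (∫ θ in (-Real.pi)..Real.pi, F (polarPoint c R θ)) - Real.pi * F c := by
  have hd := hF.differentiable one_ne_zero
  have hD : Continuous fun q : ℝ × ℝ => fderiv ℝ F (polarPoint c q.1 q.2) :=
    (hF.continuous_fderiv one_ne_zero).comp (continuous_polarPoint c)
  have hAc : Continuous fun q : ℝ × ℝ =>
      fderiv ℝ F (polarPoint c q.1 q.2) (Real.cos q.2, Real.sin q.2) :=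
    hD.clm_apply (by fun_prop)
  have hBc : Continuous fun q : ℝ × ℝ =>
      fderiv ℝ F (polarPoint c q.1 q.2) (-Real.sin q.2, Real.cos q.2) :=
    hD.clm_apply (by fun_prop)
  have hint : ∀ {g : ℝ × ℝ → ℂ}, Continuous g →
      IntegrableOn g (Set.Ioc 0 R ×ˢ Set.Ioc (-Real.pi) Real.pi)
        ((volume : Measure ℝ).prod volume) := fun hg =>
    (hg.continuousOn.integrableOn_compact (isCompact_Icc.prod isCompact_Icc)).mono_set
      (Set.prod_mono Set.Ioc_subset_Icc_self Set.Ioc_subset_Icc_self)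
  have hpi : -Real.pi ≤ Real.pi := by linarith [Real.pi_pos]
  rw [integral_const_mul]
  have hA : ∫ q in Set.Ioc 0 R ×ˢ Set.Ioc (-Real.pi) Real.pi,
      fderiv ℝ F (polarPoint c q.1 q.2) (Real.cos q.2, Real.sin q.2) =
      (∫ θ in (-Real.pi)..Real.pi, F (polarPoint c R θ)) - 2 * Real.pi * F c := by
    rw [Measure.volume_eq_prod, ← setIntegral_prod_swap, setIntegral_prod]
    swap
    · exact ((hAc.comp continuous_swap).continuousOn.integrableOn_compact
        (isCompact_Icc.prod isCompact_Icc)).mono_set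
        (Set.prod_mono Set.Ioc_subset_Icc_self Set.Ioc_subset_Icc_self)
    have h1 : ∀ θ : ℝ, ∫ r in Set.Ioc 0 R,
        fderiv ℝ F (polarPoint c r θ) (Real.cos θ, Real.sin θ) = F (polarPoint c R θ) - F c := by
      intro θ
      rw [← intervalIntegral.integral_of_le hR,
        intervalIntegral.integral_eq_sub_of_hasDerivAt
          (fun r _ => hasDerivAt_polarPoint_radial hd c r θ)
          ((hAc.comp (by fun_prop : Continuous fun r : ℝ => (r, θ))).intervalIntegrable _ _)]
      simp [polarPoint, Prod.mk_zero_zero]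
    simp only [Prod.swap, h1]
    have h2 : Continuous fun θ : ℝ => F (polarPoint c R θ) :=
      hF.continuous.comp ((continuous_polarPoint c).comp
        (by fun_prop : Continuous fun θ : ℝ => (R, θ)))
    rw [← intervalIntegral.integral_of_le hpi, intervalIntegral.integral_sub
      (h2.intervalIntegrable _ _) intervalIntegrable_const, intervalIntegral.integral_const,
      Complex.real_smul]
    push_cast
    ring
  have hB : ∫ q in Set.Ioc 0 R ×ˢ Set.Ioc (-Real.pi) Real.pi,
      fderiv ℝ F (polarPoint c q.1 q.2) (-Real.sin q.2, Real.cos q.2) = 0 := by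
    rw [Measure.volume_eq_prod, setIntegral_prod _ (hint hBc)]
    refine setIntegral_eq_zero_of_forall_eq_zero fun r hr => ?_
    have hr0 : r ≠ 0 := hr.1.ne'
    have h1 := intervalIntegral.integral_eq_sub_of_hasDerivAt (a := -Real.pi) (b := Real.pi)
      (fun θ _ => hasDerivAt_polarPoint_angular hd c r θ)
      (((hBc.comp (by fun_prop : Continuous fun θ : ℝ => (r, θ))).const_smul r).intervalIntegrable
        _ _)
    rw [intervalIntegral.integral_smul] at h1
    have h2 : polarPoint c r Real.pi = polarPoint c r (-Real.pi) := by simp [polarPoint]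
    rw [h2, sub_self, smul_eq_zero, or_iff_right hr0] at h1
    rwa [← intervalIntegral.integral_of_le hpi]
  have hsplit := integral_add (hint hAc) ((hint hBc).const_mul Complex.I)
  rw [integral_const_mul] at hsplit
  rw [Measure.volume_eq_prod] at hA hB ⊢
  rw [hsplit, hA, hB]
  ring

theorem tendsto_integral_polarPoint {F : ℝ × ℝ → ℂ}
    (hlim : Filter.Tendsto F (Filter.cocompact (ℝ × ℝ)) (nhds 0)) (c : ℝ × ℝ) :
    Filter.Tendsto (fun R : ℝ => ∫ θ in (-Real.pi)..Real.pi, F (polarPoint c R θ))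
      Filter.atTop (nhds 0) := by
  rw [Metric.tendsto_nhds]
  intro ε hε
  have hpi := Real.pi_pos
  have h1 : ∀ᶠ p in Filter.cocompact (ℝ × ℝ), ‖F p‖ ≤ ε / (4 * Real.pi) := by
    filter_upwards [(Metric.tendsto_nhds.1 hlim) (ε / (4 * Real.pi)) (by positivity)] with p hp
    rw [dist_zero_right] at hp
    exact hp.le
  rw [← Metric.cobounded_eq_cocompact, ← comap_norm_atTop, Filter.eventually_comap] at h1
  obtain ⟨ρ, hρ⟩ := Filter.eventually_atTop.1 h1
  filter_upwards [Filter.eventually_ge_atTop (2 * (ρ + ‖c‖)), Filter.eventually_ge_atTop 0]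
    with R hR hR0
  rw [dist_zero_right]
  have h2 : ∀ θ : ℝ, ‖F (polarPoint c R θ)‖ ≤ ε / (4 * Real.pi) := by
    intro θ
    refine hρ _ ?_ _ rfl
    have h3 : R / 2 ≤ ‖((R * Real.cos θ, R * Real.sin θ) : ℝ × ℝ)‖ := by
      rw [Prod.norm_def, Real.norm_eq_abs, Real.norm_eq_abs, abs_mul, abs_mul, abs_of_nonneg hR0]
      have h4 := Real.cos_sq_add_sin_sq θ
      rcases le_total (1 / 2) |Real.cos θ| with h | h
      · exact le_max_of_le_left (by nlinarith)
      · refine le_max_of_le_right ?_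
        have h5 : 1 / 2 ≤ |Real.sin θ| := by
          rw [← sq_abs (Real.cos θ), ← sq_abs (Real.sin θ)] at h4
          nlinarith [abs_nonneg (Real.cos θ), abs_nonneg (Real.sin θ)]
        nlinarith
    have h6 := norm_sub_norm_le ((R * Real.cos θ, R * Real.sin θ) : ℝ × ℝ) (-c)
    rw [sub_neg_eq_add, norm_neg, add_comm _ c] at h6
    unfold polarPoint
    linarith
  have h7 := intervalIntegral.norm_integral_le_of_norm_le_const (a := -Real.pi) (b := Real.pi)
    (fun θ _ => h2 θ)
  have h8 : ε / (4 * Real.pi) * |Real.pi - -Real.pi| = ε / 2 := by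
    rw [abs_of_pos (by linarith)]
    field_simp
    ring
  rw [h8] at h7
  linarith

/-- Cauchy–Pompeiu formula on the whole plane, for a `C¹` function vanishing at infinity:
`F(c) = -(1/π) ∬ (∂F/∂z̄) (z - c)⁻¹ dx dy`. -/
theorem integral_dbar_mul_inv_sub {F : ℝ × ℝ → ℂ} (hF : ContDiff ℝ 1 F)
    (hlim : Filter.Tendsto F (Filter.cocompact (ℝ × ℝ)) (nhds 0)) (c : ℝ × ℝ)
    (hint : Integrable fun p : ℝ × ℝ => dbar F p *
      (((p.1 : ℂ) + (p.2 : ℂ) * Complex.I) - ((c.1 : ℂ) + (c.2 : ℂ) * Complex.I))⁻¹) :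
    ∫ p : ℝ × ℝ, dbar F p *
      (((p.1 : ℂ) + (p.2 : ℂ) * Complex.I) - ((c.1 : ℂ) + (c.2 : ℂ) * Complex.I))⁻¹ =
      -(Real.pi : ℂ) * F c := by
  set g : ℝ × ℝ → ℂ := fun p => dbar F (c + p) * ((p.1 : ℂ) + (p.2 : ℂ) * Complex.I)⁻¹ with hg
  have hshift : ∀ p : ℝ × ℝ, g p = (fun p : ℝ × ℝ => dbar F p * (((p.1 : ℂ) + (p.2 : ℂ) *
      Complex.I) - ((c.1 : ℂ) + (c.2 : ℂ) * Complex.I))⁻¹) (c + p) := by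
    intro p
    simp only [hg, Prod.fst_add, Prod.snd_add]
    congr 2
    push_cast
    ring
  have hgint : Integrable g := by
    rw [funext hshift]
    exact hint.comp_add_left c
  rw [← integral_add_left_eq_self _ c, ← integral_congr_ae (Filter.Eventually.of_forall hshift)]
  -- exhaust the plane by the Euclidean discs of radius `k`
  set S : ℕ → Set (ℝ × ℝ) := fun k => {p | p.1 ^ 2 + p.2 ^ 2 ≤ (k : ℝ) ^ 2} with hS
  have hSm : ∀ k, MeasurableSet (S k) := fun k =>
    (isClosed_le (by fun_prop) continuous_const).measurableSet
  have hSmono : Monotone S := by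
    intro j k hjk p hp
    simp only [hS, Set.mem_ofPred_eq] at hp ⊢
    exact hp.trans (by gcongr)
  have hSU : ⋃ k, S k = Set.univ := by
    refine Set.eq_univ_of_forall fun p => Set.mem_iUnion.2 ?_
    obtain ⟨k, hk⟩ := exists_nat_ge (Real.sqrt (p.1 ^ 2 + p.2 ^ 2))
    exact ⟨k, (Real.sqrt_le_left (Nat.cast_nonneg k)).1 hk⟩
  have hconv := tendsto_setIntegral_of_monotone hSm hSmono hgint.integrableOn
  rw [hSU, setIntegral_univ] at hconv
  have hdisc : ∀ k : ℕ, ∫ p in S k, g p =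
      (1 / 2 : ℂ) * (∫ θ in (-Real.pi)..Real.pi, F (polarPoint c k θ)) - Real.pi * F c := by
    intro k
    rw [← setIntegral_polar_fderiv hF c (Nat.cast_nonneg k), ← integral_indicator (hSm k),
      ← integral_comp_polarCoord_symm]
    have htarget : polarCoord.target = Set.Ioi (0 : ℝ) ×ˢ Set.Ioo (-Real.pi) Real.pi := rfl
    have hpt : ∀ q ∈ polarCoord.target, q.1 • (S k).indicator g (polarCoord.symm q) =
        (Set.Ioc (0 : ℝ) k ×ˢ (Set.univ : Set ℝ)).indicator (fun q => (1 / 2 : ℂ) *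
          (fderiv ℝ F (polarPoint c q.1 q.2) (Real.cos q.2, Real.sin q.2) + Complex.I *
            fderiv ℝ F (polarPoint c q.1 q.2) (-Real.sin q.2, Real.cos q.2))) q := by
      intro q hq
      have hq0 : 0 < q.1 := hq.1
      have hmem : polarCoord.symm q ∈ S k ↔ q ∈ Set.Ioc (0 : ℝ) k ×ˢ (Set.univ : Set ℝ) := by
        have h1 : (q.1 * Real.cos q.2) ^ 2 + (q.1 * Real.sin q.2) ^ 2 = q.1 ^ 2 := by
          linear_combination q.1 ^ 2 * Real.cos_sq_add_sin_sq q.2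
        simp only [hS, polarCoord_symm_apply, Set.mem_ofPred_eq, h1, Set.mem_prod, Set.mem_Ioc,
          hq0, true_and, Set.mem_univ, and_true]
        exact pow_le_pow_iff_left₀ hq0.le (Nat.cast_nonneg k) two_ne_zero
      by_cases h : polarCoord.symm q ∈ S k
      · rw [Set.indicator_of_mem h, Set.indicator_of_mem (hmem.1 h), polarCoord_symm_apply,
          ← smul_dbar_mul_inv_polar (hF.differentiable one_ne_zero) _ hq0.ne']
        rfl
      · rw [Set.indicator_of_notMem h, Set.indicator_of_notMem (fun h' => h (hmem.2 h')),
          smul_zero]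
    rw [setIntegral_congr_fun polarCoord.open_target.measurableSet hpt,
      setIntegral_indicator (measurableSet_Ioc.prod MeasurableSet.univ), htarget,
      Set.prod_inter_prod, Set.inter_univ, Set.inter_eq_self_of_subset_right Set.Ioc_subset_Ioi_self]
    exact setIntegral_congr_set
      (Measure.set_prod_ae_eq (μ := volume) (ν := volume) (Filter.EventuallyEq.refl _ _)
        Ioo_ae_eq_Ioc)
  have hlim2 := (((tendsto_integral_polarPoint hlim c).comp
    tendsto_natCast_atTop_atTop).const_mul (1 / 2 : ℂ)).sub_const (Real.pi * F c)
  refine tendsto_nhds_unique hconv ?_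
  convert hlim2 using 2 with k
  · exact hdisc k
  · ring

/-! ### The Helffer–Sjöstrand calculus on approximate eigenvectors -/

variable {B : Type*} [NormedAddCommGroup B] [NormedSpace ℂ B]

theorem integrable_hsIntegrand {H : B →ₗ.[ℂ] B} {α : ℝ} (hH : ResolventHypothesis H α) {n : ℕ}
    (hn : α < (n : ℝ)) {τ : ℝ × ℝ → ℝ} (hτ : IsCutoff τ) {f : ℝ → ℂ} (hf : f ∈ slowAlgebra) :
    Integrable (hsIntegrand H n τ f) := by
  obtain ⟨c, hc⟩ := hH.bound
  exact integrable_dbar_smul hf hτ hH.exponent_nonneg hn hH.continuousOn_opResolvent hc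

theorem ne_ofReal_of_im_ne_zero {z : ℂ} (hz : z.im ≠ 0) (s : ℝ) : z ≠ s := by
  rintro rfl
  exact hz (Complex.ofReal_im s)

/-- The kernel `(z - s)⁻¹` obeys the resolvent bound with `α = 0`. -/
theorem integrable_dbar_mul_inv_sub {n : ℕ} (hn : 0 < (n : ℝ)) {τ : ℝ × ℝ → ℝ} (hτ : IsCutoff τ)
    {f : ℝ → ℂ} (hf : f ∈ slowAlgebra) (s : ℝ) :
    Integrable fun p : ℝ × ℝ => dbar (almostAnalytic n τ f) p *
      ((p.1 : ℂ) + (p.2 : ℂ) * Complex.I - s)⁻¹ := by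
  refine integrable_dbar_smul (G := fun z : ℂ => (z - s)⁻¹) (c := 1) hf hτ le_rfl hn ?_ ?_
  · exact ContinuousOn.inv₀ (by fun_prop) fun z hz =>
      sub_ne_zero.2 (ne_ofReal_of_im_ne_zero hz s)
  · intro z hz
    rw [Real.rpow_zero, one_mul, mul_one, norm_inv]
    have h1 : |z.im| ≤ ‖z - s‖ := by simpa using Complex.abs_im_le_norm (z - s)
    exact inv_anti₀ (abs_pos.2 hz) h1

/-- The Helffer–Sjöstrand formula for the scalar `s` in place of `H` returns `f(s)`. -/
theorem integral_dbar_almostAnalytic_mul_inv_sub {n : ℕ} (hn : 0 < (n : ℝ)) {τ : ℝ × ℝ → ℝ}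
    (hτ : IsCutoff τ) {f : ℝ → ℂ} (hf : f ∈ slowAlgebra) (s : ℝ) :
    ∫ p : ℝ × ℝ, dbar (almostAnalytic n τ f) p * ((p.1 : ℂ) + (p.2 : ℂ) * Complex.I - s)⁻¹ =
      -(Real.pi : ℂ) * f s := by
  have hint := integrable_dbar_mul_inv_sub hn hτ hf s
  obtain ⟨β, hβ, hfβ⟩ : ∃ β : ℝ, β < 0 ∧ f ∈ symbolClass β := by
    simpa [slowAlgebra] using hf
  have h1 := integral_dbar_mul_inv_sub
    ((contDiff_almostAnalytic hfβ.1 hτ n).of_le (by exact_mod_cast le_top))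
    (tendsto_almostAnalytic_cocompact hβ hfβ hτ n) (s, 0)
  have h2 : almostAnalytic n τ f (s, 0) = f s := by
    have h3 : τ (s, 0) = 1 := hτ.eq_one s 0 (by simpa using (bracket_pos (s : ℂ)).le)
    simp [almostAnalytic, h3, Finset.sum_range_succ']
  rw [h2] at h1
  simp only [Complex.ofReal_zero, zero_mul, add_zero] at h1
  exact h1 hint

/-- If `(H - s) u_k → 0` with `u_k` normalised, then `f(H) u_k - f(s) u_k → 0`: the difference is
the integral of `∂f̃/∂z̄` against `(z - H)⁻¹ u_k - (z - s)⁻¹ u_k`, which tends to zero at every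
non-real `z` and there has norm at most `‖(z - H)⁻¹‖ + |z - s|⁻¹`. -/
theorem tendsto_hsCalculus_apply_sub [CompleteSpace B] {H : B →ₗ.[ℂ] B} {α : ℝ}
    (hH : ResolventHypothesis H α) {n : ℕ} (hn : α < (n : ℝ)) {τ : ℝ × ℝ → ℝ} (hτ : IsCutoff τ)
    {f : ℝ → ℂ} (hf : f ∈ slowAlgebra) {s : ℝ} {u : ℕ → H.domain} (hu : ∀ k, ‖(u k : B)‖ = 1)
    (hlim : Filter.Tendsto (fun k => H (u k) - (s : ℂ) • (u k : B)) Filter.atTop (nhds 0)) :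
    Filter.Tendsto (fun k => hsCalculus H n τ f (u k) - f s • (u k : B)) Filter.atTop
      (nhds 0) := by
  have hn0 : 0 < (n : ℝ) := hH.exponent_nonneg.trans_lt hn
  have hint := integrable_hsIntegrand hH hn hτ hf
  have hint' := integrable_dbar_mul_inv_sub hn0 hτ hf s
  have hpi : (Real.pi : ℂ) ≠ 0 := by exact_mod_cast Real.pi_ne_zero
  set D : ℕ → ℝ × ℝ → B := fun k p => hsIntegrand H n τ f p (u k) -
    (dbar (almostAnalytic n τ f) p * ((p.1 : ℂ) + (p.2 : ℂ) * Complex.I - s)⁻¹) • (u k : B)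
    with hD
  have hintu : ∀ k, Integrable fun p => hsIntegrand H n τ f p (u k) := fun k =>
    hint.apply_continuousLinearMap (u k : B)
  have hrepr : ∀ k, hsCalculus H n τ f (u k) - f s • (u k : B) =
      (-(1 / (Real.pi : ℂ))) • ∫ p, D k p := by
    intro k
    rw [hD, integral_sub (hintu k) (hint'.smul_const _), integral_smul_const,
      integral_dbar_almostAnalytic_mul_inv_sub hn0 hτ hf s,
      ← ContinuousLinearMap.integral_apply hint, smul_sub, smul_smul]
    congr 2
    field_simp
  have hDlim : Filter.Tendsto (fun k => ∫ p, D k p) Filter.atTop (nhds (∫ _ : ℝ × ℝ, (0 : B))) := by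
    refine tendsto_integral_of_dominated_convergence
      (fun p => ‖hsIntegrand H n τ f p‖ + ‖dbar (almostAnalytic n τ f) p *
        ((p.1 : ℂ) + (p.2 : ℂ) * Complex.I - s)⁻¹‖)
      (fun k => ((hintu k).sub (hint'.smul_const _)).aestronglyMeasurable)
      (hint.norm.add hint'.norm) (fun k => Filter.Eventually.of_forall fun p => ?_) ?_
    · refine (norm_sub_le _ _).trans (add_le_add ?_ ?_)
      · simpa [hu k] using (hsIntegrand H n τ f p).le_opNorm (u k)
      · rw [norm_smul, hu k, mul_one]
    · filter_upwards [ae_snd_ne_zero] with p hp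
      have hz : ((p.1 : ℂ) + (p.2 : ℂ) * Complex.I).im ≠ 0 := by simpa using hp
      set z : ℂ := (p.1 : ℂ) + (p.2 : ℂ) * Complex.I with hzdef
      have h1 : ∀ k, D k p = dbar (almostAnalytic n τ f) p •
          (z - s)⁻¹ • opResolvent H z (H (u k) - (s : ℂ) • (u k : B)) := fun k => by
        rw [← opResolvent_apply_sub_inv_smul (hH.mem_opResolventSet hz)
          (ne_ofReal_of_im_ne_zero hz s), smul_sub, smul_smul]
        rfl
      have h2 := (((opResolvent H z).continuous.tendsto _).comp hlim).const_smul (z - (s : ℂ))⁻¹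
      have h3 := h2.const_smul (dbar (almostAnalytic n τ f) p)
      simp only [map_zero, smul_zero] at h3
      exact h3.congr fun k => (h1 k).symm
  rw [integral_zero] at hDlim
  have h4 := hDlim.const_smul (-(1 / (Real.pi : ℂ)))
  rw [smul_zero] at h4
  exact h4.congr fun k => (hrepr k).symm

theorem mem_spectrum_hsCalculus [CompleteSpace B] {H : B →ₗ.[ℂ] B} {α : ℝ}
    (hH : ResolventHypothesis H α) {n : ℕ} (hn : α < (n : ℝ)) {τ : ℝ × ℝ → ℝ} (hτ : IsCutoff τ)
    {f : ℝ → ℂ} (hf : f ∈ slowAlgebra) {s : ℝ} (hs : (s : ℂ) ∈ opSpectrum H) :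
    f s ∈ spectrum ℂ (hsCalculus H n τ f) := by
  choose u hu1 hu2 using fun k : ℕ => exists_norm_eq_one_norm_apply_sub_smul_le
    hH.spectrum_real hs (Nat.one_div_pos_of_nat (α := ℝ) (n := k))
  refine mem_spectrum_of_tendsto_zero hu1 (tendsto_hsCalculus_apply_sub hH hn hτ hf hu1 ?_)
  refine squeeze_zero_norm hu2 ?_
  simpa using (tendsto_one_div_add_atTop_nhds_zero_nat (𝕜 := ℝ)).const_mul 3

end HelfferSjostrand

end

theorem mainTheorem2 {B : Type*} [NormedAddCommGroup B] [NormedSpace ℂ B] [CompleteSpace B]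
    (H : B →ₗ.[ℂ] B) (α : ℝ) (hH : HelfferSjostrand.ResolventHypothesis H α)
    (n : ℕ) (hn : α < (n : ℝ)) (τ : ℝ × ℝ → ℝ) (hτ : HelfferSjostrand.IsCutoff τ)
    (f : ℝ → ℂ) (hf : f ∈ HelfferSjostrand.slowAlgebra) :
    MeasureTheory.Integrable (HelfferSjostrand.hsIntegrand H n τ f) ∧
      closure (f '' {s : ℝ | (s : ℂ) ∈ HelfferSjostrand.opSpectrum H}) ⊆
        spectrum ℂ (HelfferSjostrand.hsCalculus H n τ f) := by
  refine ⟨HelfferSjostrand.integrable_hsIntegrand hH hn hτ hf,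
    closure_minimal ?_ (spectrum.isClosed _)⟩
  rintro _ ⟨s, hs, rfl⟩
  exact HelfferSjostrand.mem_spectrum_hsCalculus hH hn hτ hf hs
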